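/- Let $\mathbb{K}$ be a field and let $q\in\mathbb{K}\setminus\{0\}$ be an element which is not a root of unity. Let $\mathcal{A}$ be the quantum spatial ageing algebra, that is, the associative unital $\mathbb{K}$-algebra generated by $E, K, K^{-1}, X, Y$ subject to the defining relations $KK^{-1}=K^{-1}K=1$ and $$EK=q^{-2}KE,\quad XK=q^{-1}KX,\quad YK=qKY,\quad EX=qXE,\quad EY=X+q^{-1}YE,\quad qYX=XY.$$ A two-sided ideal $P\neq\mathcal{A}$ is called prime if, for all two-sided ideals $I,J$ of $\mathcal{A}$, $IJ\subseteq P$ implies $I\subseteq P$ or $J\subseteq P$; a prime ideal $P$ is called completely prime if the factor algebra $\mathcal{A}/P$ is a domain. Then every prime ideal of $\mathcal{A}$ is completely prime; that is, the set $\mathrm{Spec}_c(\mathcal{A})$ of completely prime ideals of $\mathcal{A}$ equals the set $\mathrm{Spec}(\mathcal{A})$ of prime ideals of $\mathcal{A}$. -/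

import Mathlib

/-- The five canonical generators `E, K, K⁻¹, X, Y`. -/
inductive AgeingGen : Type
  | E
  | K
  | Kinv
  | X
  | Y

namespace QuantumAgeing

variable {𝕜 : Type*} [Field 𝕜]

/-- A generator, as an element of the free associative algebra on the five generators. -/
abbrev gen (𝕜 : Type*) [Field 𝕜] (g : AgeingGen) : FreeAlgebra 𝕜 AgeingGen :=
  FreeAlgebra.ι 𝕜 g

open AgeingGen in
/-- The defining relations of the quantum spatial ageing algebra. The first two say that
`Kinv` is the two-sided inverse of `K`. -/
inductive Rel (q : 𝕜) : FreeAlgebra 𝕜 AgeingGen → FreeAlgebra 𝕜 AgeingGen → Prop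
  | K_Kinv : Rel q (gen 𝕜 K * gen 𝕜 Kinv) 1
  | Kinv_K : Rel q (gen 𝕜 Kinv * gen 𝕜 K) 1
  | E_K : Rel q (gen 𝕜 E * gen 𝕜 K) ((q⁻¹) ^ 2 • (gen 𝕜 K * gen 𝕜 E))
  | X_K : Rel q (gen 𝕜 X * gen 𝕜 K) (q⁻¹ • (gen 𝕜 K * gen 𝕜 X))
  | Y_K : Rel q (gen 𝕜 Y * gen 𝕜 K) (q • (gen 𝕜 K * gen 𝕜 Y))
  | E_X : Rel q (gen 𝕜 E * gen 𝕜 X) (q • (gen 𝕜 X * gen 𝕜 E))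
  | E_Y : Rel q (gen 𝕜 E * gen 𝕜 Y) (gen 𝕜 X + q⁻¹ • (gen 𝕜 Y * gen 𝕜 E))
  | Y_X : Rel q (q • (gen 𝕜 Y * gen 𝕜 X)) (gen 𝕜 X * gen 𝕜 Y)

end QuantumAgeing

/-- The quantum spatial ageing algebra: the associative unital `𝕜`-algebra generated by
`E, K, K⁻¹, X, Y` subject to the defining relations. -/
abbrev QuantumAgeingAlgebra {𝕜 : Type*} [Field 𝕜] (q : 𝕜) : Type _ :=
  RingQuot (QuantumAgeing.Rel q)

namespace QuantumAgeing

variable {A : Type*} [Ring A]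

/-- A (two-sided) prime ideal of a ring: a proper ideal `P` such that `I J ⊆ P`, for ideals `I`
and `J`, implies `I ⊆ P` or `J ⊆ P`. (As `P` is closed under sums, `I J ⊆ P` means that `P`
contains all products `a * b` with `a ∈ I` and `b ∈ J`.) -/
def IsPrimeIdeal (P : TwoSidedIdeal A) : Prop :=
  P ≠ ⊤ ∧ ∀ I J : TwoSidedIdeal A, (∀ a ∈ I, ∀ b ∈ J, a * b ∈ P) → I ≤ P ∨ J ≤ P

/-- A prime ideal `P` is completely prime if the factor ring `A / P` is a domain. -/
def IsCompletelyPrimeIdeal (P : TwoSidedIdeal A) : Prop :=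
  IsPrimeIdeal P ∧ IsDomain P.ringCon.Quotient

/-- The prime spectrum: the set of (two-sided) prime ideals. -/
def Spec (A : Type*) [Ring A] : Set (TwoSidedIdeal A) := {P | IsPrimeIdeal P}

/-- The completely prime spectrum: the set of completely prime ideals. -/
def SpecC (A : Type*) [Ring A] : Set (TwoSidedIdeal A) := {P | IsCompletelyPrimeIdeal P}

end QuantumAgeing

/-! Let `B` be the quotient by a prime ideal. The elements `X` and `φ = X + (q⁻¹ - q) Y E` commute
with every generator up to a power of `q`. Such an element of a prime ring is zero or regular
(`isRegular_of_hasWeight`).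

If `X` or `φ` vanishes in `B`, then `E` and `Y` also commute up to a power of `q`, so all generators
do. The nonzero generators are regular, and their commutation weights decompose `B` into independent
pieces whose nonzero elements are again regular. Weights add and form a group with unique sums, so
`B` is a domain (`noZeroDivisors_of_hasWeight`).

If both are regular, let `D` be the commutative subalgebra they generate. Up to nonzero scalars, `Y
E` and `E Y` are `φ - X` and `φ - q² X`. Carrying `E` or `Y` through a homogeneous relation between
`X` and `φ` twists its coefficients in opposite ways, and a relation of minimal degree cannot
survive both twists (`coeff_eq_zero_of_form_eq_zero`). Since `K` separates degrees, `D` is a domain.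
Now `B` is the sum of the pieces `K ^ i * Z_n * D`, where `Z_n` is `E ^ n` or `Y ^ (-n)`. The
weights for `X` and `φ` separate these pieces, and multiplying by opposite `Z`'s reduces a zero
product of homogeneous elements to one in `D`. -/

namespace QuantumAgeing

/-! ### Elements commuting up to powers of `q`, and gradings by weights -/

section Weights

variable {𝕜 B : Type*} [Field 𝕜] [Ring B] [Algebra 𝕜 B] {q : 𝕜}

/-- `b` has weight `n` with respect to `t`: moving `t` past `b` costs a factor `q ^ n`. -/
def HasWeight (q : 𝕜) (t b : B) (n : ℤ) : Prop := t * b = q ^ n • (b * t)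

theorem HasWeight.zero (t : B) (n : ℤ) : HasWeight q t 0 n := by simp [HasWeight]

theorem HasWeight.one (t : B) : HasWeight q t 1 0 := by simp [HasWeight]

theorem HasWeight.add {t a b : B} {n : ℤ} (ha : HasWeight q t a n) (hb : HasWeight q t b n) :
    HasWeight q t (a + b) n := by
  unfold HasWeight at *
  rw [mul_add, add_mul, smul_add, ha, hb]

theorem HasWeight.smul {t b : B} {n : ℤ} (c : 𝕜) (hb : HasWeight q t b n) :
    HasWeight q t (c • b) n := by
  unfold HasWeight at *
  rw [mul_smul_comm, hb, smul_mul_assoc, smul_comm]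

theorem HasWeight.mul (hq0 : q ≠ 0) {t a b : B} {m n : ℤ} (ha : HasWeight q t a m)
    (hb : HasWeight q t b n) : HasWeight q t (a * b) (m + n) := by
  unfold HasWeight at *
  rw [← mul_assoc, ha, smul_mul_assoc, mul_assoc, hb, mul_smul_comm, smul_smul, mul_assoc,
    zpow_add₀ hq0]

theorem HasWeight.pow (hq0 : q ≠ 0) {t a : B} {m : ℤ} (ha : HasWeight q t a m) (k : ℕ) :
    HasWeight q t (a ^ k) (k * m) := by
  induction k with
  | zero => simpa using HasWeight.one t
  | succ k ih =>
    rw [pow_succ]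
    convert ih.mul hq0 ha using 1
    push_cast; ring

theorem HasWeight.symm (hq0 : q ≠ 0) {t a : B} {m : ℤ} (ha : HasWeight q t a m) :
    HasWeight q a t (-m) := by
  unfold HasWeight at *
  rw [ha, smul_smul, ← zpow_add₀ hq0]
  simp

theorem HasWeight.inv (hq0 : q ≠ 0) {t : B} {u : Bˣ} {m : ℤ} (h : HasWeight q t (u : B) m) :
    HasWeight q t ((u⁻¹ : Bˣ) : B) (-m) := by
  have h' := h.symm hq0
  unfold HasWeight at *
  have := congrArg (fun x => ((u⁻¹ : Bˣ) : B) * x * ((u⁻¹ : Bˣ) : B)) h'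
  simpa [mul_assoc] using this

theorem HasWeight.zpow (hq0 : q ≠ 0) {t : B} {u : Bˣ} {m : ℤ} (h : HasWeight q t (u : B) m)
    (k : ℤ) : HasWeight q t ((u ^ k : Bˣ) : B) (k * m) := by
  obtain ⟨n, rfl | rfl⟩ := k.eq_nat_or_neg
  · rw [zpow_natCast, Units.val_pow_eq_pow_val]
    exact h.pow hq0 n
  · rw [zpow_neg, zpow_natCast, ← inv_pow, Units.val_pow_eq_pow_val]
    have := (h.inv hq0).pow hq0 n
    rwa [neg_mul, ← mul_neg]

/-- If `v` commutes up to powers of `q` with the generators of a subalgebra, then that subalgebra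
can be moved past `v` from right to left. -/
theorem exists_mul_eq_mul_left {S : Set B} {v : B} (h : ∀ s ∈ S, ∃ n, HasWeight q v s n) {d : B}
    (hd : d ∈ Algebra.adjoin 𝕜 S) : ∃ d' ∈ Algebra.adjoin 𝕜 S, v * d = d' * v := by
  induction hd using Algebra.adjoin_induction with
  | mem s hs =>
    obtain ⟨n, hn⟩ := h s hs
    exact ⟨q ^ n • s, Subalgebra.smul_mem _ (Algebra.subset_adjoin hs) _, by
      rw [smul_mul_assoc]; exact hn⟩
  | algebraMap r =>
    exact ⟨_, Subalgebra.algebraMap_mem _ r, (Algebra.commutes r v).symm⟩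
  | add x y _ _ hx hy =>
    obtain ⟨x', hx', ex⟩ := hx
    obtain ⟨y', hy', ey⟩ := hy
    exact ⟨x' + y', add_mem hx' hy', by rw [mul_add, add_mul, ex, ey]⟩
  | mul x y _ _ hx hy =>
    obtain ⟨x', hx', ex⟩ := hx
    obtain ⟨y', hy', ey⟩ := hy
    exact ⟨x' * y', mul_mem hx' hy', by rw [← mul_assoc, ex, mul_assoc, ey, mul_assoc]⟩

/-- If `v` commutes up to powers of `q` with the generators of a subalgebra, then that subalgebra
can be moved past `v` from left to right. -/
theorem exists_mul_eq_mul_right (hq0 : q ≠ 0) {S : Set B} {v : B}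
    (h : ∀ s ∈ S, ∃ n, HasWeight q v s n) {d : B}
    (hd : d ∈ Algebra.adjoin 𝕜 S) : ∃ d' ∈ Algebra.adjoin 𝕜 S, d * v = v * d' := by
  induction hd using Algebra.adjoin_induction with
  | mem s hs =>
    obtain ⟨n, hn⟩ := h s hs
    exact ⟨q ^ (-n) • s, Subalgebra.smul_mem _ (Algebra.subset_adjoin hs) _, by
      rw [mul_smul_comm]; exact hn.symm hq0⟩
  | algebraMap r =>
    exact ⟨_, Subalgebra.algebraMap_mem _ r, Algebra.commutes r v⟩
  | add x y _ _ hx hy =>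
    obtain ⟨x', hx', ex⟩ := hx
    obtain ⟨y', hy', ey⟩ := hy
    exact ⟨x' + y', add_mem hx' hy', by rw [mul_add, add_mul, ex, ey]⟩
  | mul x y _ _ hx hy =>
    obtain ⟨x', hx', ex⟩ := hx
    obtain ⟨y', hy', ey⟩ := hy
    exact ⟨x' * y', mul_mem hx' hy', by rw [mul_assoc, ey, ← mul_assoc, ex, mul_assoc]⟩

/-- The elementwise form of primeness of a ring. -/
def IsPrimeRing (B : Type*) [Ring B] : Prop :=
  ∀ a b : B, (∀ r, a * r * b = 0) → a = 0 ∨ b = 0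

/-- In a prime ring, a nonzero element commuting up to powers of `q` with all generators is
regular. -/
theorem isRegular_of_hasWeight (hB : IsPrimeRing B) (hq0 : q ≠ 0) {S : Set B}
    (hS : Algebra.adjoin 𝕜 S = ⊤) {v : B} (hv : v ≠ 0)
    (h : ∀ s ∈ S, ∃ n, HasWeight q v s n) (b : B) :
    (v * b = 0 → b = 0) ∧ (b * v = 0 → b = 0) := by
  have mem (r : B) : r ∈ Algebra.adjoin 𝕜 S := hS ▸ Algebra.mem_top
  constructor <;> intro hb
  -- Moving `v` to the right past `r` gives `v * r * b = r' * (v * b) = 0` for every `r`, so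
  -- primeness applies.
  · refine (hB v b fun r => ?_).resolve_left hv
    obtain ⟨r', -, hr'⟩ := exists_mul_eq_mul_left h (mem r)
    rw [hr', mul_assoc, hb, mul_zero]
  · refine (hB b v fun r => ?_).resolve_right hv
    obtain ⟨r', -, hr'⟩ := exists_mul_eq_mul_right hq0 h (mem r)
    rw [mul_assoc, hr', ← mul_assoc, hb, zero_mul]

theorem zpow_injective_of_pow_ne_one (hq0 : q ≠ 0) (hq : ∀ n : ℕ, 0 < n → q ^ n ≠ 1) :
    Function.Injective fun n : ℤ => q ^ n := by
  have key (m n : ℤ) (hmn : m < n) : q ^ m ≠ q ^ n := by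
    intro h
    refine hq (n - m).toNat (by omega) ?_
    rw [← zpow_natCast, Int.toNat_of_nonneg (by omega), zpow_sub₀ hq0, ← h,
      div_self (zpow_ne_zero _ hq0)]
  intro m n h
  rcases lt_trichotomy m n with hmn | hmn | hmn
  · exact absurd h (key m n hmn)
  · exact hmn
  · exact absurd h.symm (key n m hmn)

/-- Elements of distinct weights with respect to a family of regular elements that commute up to
powers of `q` are independent. -/
theorem eq_zero_of_sum_eq_zero_of_hasWeight (hq0 : q ≠ 0) (hq : ∀ n : ℕ, 0 < n → q ^ n ≠ 1)
    {ι α : Type*} (t : ι → B) (ht : ∀ i b, b * t i = 0 → b = 0)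
    (htt : ∀ i j, ∃ n, HasWeight q (t i) (t j) n) (S : Finset α) :
    ∀ (w : α → ι → ℤ) (f : α → B), Set.InjOn w S →
      (∀ a ∈ S, ∀ i, HasWeight q (t i) (f a) (w a i)) → ∑ a ∈ S, f a = 0 →
      ∀ a ∈ S, f a = 0 := by
  classical
  induction S using Finset.induction_on with
  | empty => simp
  | insert v S hv ih =>
    intro w f hw hf hsum
    have hS : ∀ u ∈ S, f u = 0 := by
      intro u hu
      have hne : w u ≠ w v := fun h => by
        have := hw (by simp [hu]) (by simp) h
        exact hv (this ▸ hu)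
      obtain ⟨i, hi⟩ := Function.ne_iff.1 hne
      choose c hc using fun j => htt j i
      -- The operation `b ↦ t i * b - q ^ w v i • (b * t i)` kills the term at `v` and turns every
      -- other `f a` into a scalar multiple of `f a * t i`. All weights shift by the same `c`, so
      -- they stay distinct.
      have h1 := ih (fun a j => w a j + c j) (fun a => (q ^ w a i - q ^ w v i) • (f a * t i))
        (by
          intro a ha b hb hab
          refine hw (by simpa using Or.inr ha) (by simpa using Or.inr hb) ?_
          funext j
          have := congrFun hab j
          simpa using this)
        (fun a ha j => ((hf a (by simp [ha]) j).mul hq0 (hc j)).smul _)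
        (by
          have e : ∑ a ∈ insert v S, (q ^ w a i - q ^ w v i) • (f a * t i) = 0 := by
            have : ∀ a ∈ insert v S, (q ^ w a i - q ^ w v i) • (f a * t i) =
                t i * f a - q ^ w v i • (f a * t i) := by
              intro a ha
              rw [hf a ha i, sub_smul]
            rw [Finset.sum_congr rfl this, Finset.sum_sub_distrib, ← Finset.mul_sum,
              ← Finset.smul_sum, ← Finset.sum_mul, hsum]
            simp
          rwa [Finset.sum_insert hv, sub_self, zero_smul, zero_add] at e)
        u hu
      rcases smul_eq_zero.1 h1 with h2 | h2
      · exact absurd (zpow_injective_of_pow_ne_one hq0 hq (sub_eq_zero.1 h2)) hi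
      · exact ht i _ h2
    intro a ha
    rcases Finset.mem_insert.1 ha with rfl | ha
    · rwa [Finset.sum_insert hv, Finset.sum_eq_zero hS, add_zero] at hsum
    · exact hS a ha

/-- A criterion for the absence of zero divisors, by unique sums of degrees. -/
theorem eq_zero_or_eq_zero_of_mem_iSup {J : Type*} [Add J] [UniqueSums J]
    (N N' : J → Submodule 𝕜 B)
    (hind : ∀ (S : Finset J) (f : J → B), (∀ j ∈ S, f j ∈ N' j) → ∑ j ∈ S, f j = 0 →
      ∀ j ∈ S, f j = 0)
    (hmul : ∀ i j, ∀ a ∈ N i, ∀ b ∈ N j, a * b ∈ N' (i + j))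
    (hne : ∀ i j, ∀ a ∈ N i, ∀ b ∈ N j, a * b = 0 → a = 0 ∨ b = 0)
    {a b : B} (ha : a ∈ ⨆ j, N j) (hb : b ∈ ⨆ j, N j) (hab : a * b = 0) : a = 0 ∨ b = 0 := by
  classical
  obtain ⟨f, hf, rfl⟩ := (Submodule.mem_iSup_iff_exists_finsupp _ _).1 ha
  obtain ⟨g, hg, rfl⟩ := (Submodule.mem_iSup_iff_exists_finsupp _ _).1 hb
  by_contra! hcon
  have hf0 : f.support.Nonempty := by
    rw [Finset.nonempty_iff_ne_empty]
    intro h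
    exact hcon.1 (by simp [Finsupp.sum, h])
  have hg0 : g.support.Nonempty := by
    rw [Finset.nonempty_iff_ne_empty]
    intro h
    exact hcon.2 (by simp [Finsupp.sum, h])
  -- Only `f i * g j` contributes to degree `i + j` of the product, so that single term must vanish.
  obtain ⟨i, hi, j, hj, hij⟩ := UniqueSums.uniqueAdd_of_nonempty hf0 hg0
  set T := f.support ×ˢ g.support
  have hsum : ∑ s ∈ T.image (fun p => p.1 + p.2),
      ∑ p ∈ T with p.1 + p.2 = s, f p.1 * g p.2 = 0 := by
    rw [Finset.sum_fiberwise_of_maps_to (g := fun p : J × J => p.1 + p.2)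
        (fun p hp => Finset.mem_image_of_mem _ hp) (fun p => f p.1 * g p.2),
      Finset.sum_product, ← Finset.sum_mul_sum]
    exact hab
  have h0 := hind _ _ (fun s _ => Submodule.sum_mem _ fun p hp => by
      rw [← (Finset.mem_filter.1 hp).2]
      exact hmul _ _ _ (hf _) _ (hg _)) hsum (i + j)
    (Finset.mem_image.2 ⟨(i, j), Finset.mem_product.2 ⟨hi, hj⟩, rfl⟩)
  have h1 : (T.filter fun p => p.1 + p.2 = i + j) = {(i, j)} := by
    ext ⟨x, y⟩
    simp only [Finset.mem_filter, Finset.mem_singleton, T, Finset.mem_product, Prod.mk.injEq]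
    constructor
    · rintro ⟨⟨hx, hy⟩, h⟩
      exact hij hx hy h
    · rintro ⟨rfl, rfl⟩
      exact ⟨⟨hi, hj⟩, rfl⟩
  rw [h1, Finset.sum_singleton] at h0
  rcases hne _ _ _ (hf i) _ (hg j) h0 with h | h
  · exact Finsupp.mem_support_iff.1 hi h
  · exact Finsupp.mem_support_iff.1 hj h

/-- A subalgebra generated by homogeneous elements is contained in the sum of the graded pieces. -/
theorem mem_iSup_of_mem_adjoin {J : Type*} [AddZeroClass J] (N : J → Submodule 𝕜 B)
    (hone : (1 : B) ∈ N 0) (hmul : ∀ i j, ∀ a ∈ N i, ∀ b ∈ N j, a * b ∈ N (i + j)) {S : Set B}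
    (hS : ∀ s ∈ S, ∃ j, s ∈ N j) {b : B} (hb : b ∈ Algebra.adjoin 𝕜 S) : b ∈ ⨆ j, N j := by
  induction hb using Algebra.adjoin_induction with
  | mem s hs =>
    obtain ⟨j, hj⟩ := hS s hs
    exact Submodule.mem_iSup_of_mem j hj
  | algebraMap r =>
    rw [Algebra.algebraMap_eq_smul_one]
    exact Submodule.mem_iSup_of_mem 0 (Submodule.smul_mem _ r hone)
  | add x y _ _ hx hy => exact add_mem hx hy
  | mul x y _ _ hx hy =>
    have hle : (⨆ j, N j) * (⨆ j, N j) ≤ ⨆ j, N j := by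
      rw [Submodule.iSup_mul]
      refine iSup_le fun i => ?_
      rw [Submodule.mul_iSup]
      exact iSup_le fun j => Submodule.mul_le.2 fun a ha b hb =>
        Submodule.mem_iSup_of_mem (i + j) (hmul i j a ha b hb)
    exact hle (Submodule.mul_mem_mul hx hy)

/-- The elements of weight `w` with respect to a family. -/
def weightSpace (q : 𝕜) {ι : Type*} (t : ι → B) (w : ι → ℤ) : Submodule 𝕜 B where
  carrier := {b | ∀ i, HasWeight q (t i) b (w i)}
  zero_mem' _ := HasWeight.zero _ _
  add_mem' ha hb i := (ha i).add (hb i)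
  smul_mem' c _ hb i := (hb i).smul c

/-- A prime ring generated by elements that commute with each other up to powers of `q`, where `q`
is not a root of unity, has no zero divisors. -/
theorem noZeroDivisors_of_hasWeight (hB : IsPrimeRing B) (hq0 : q ≠ 0)
    (hq : ∀ n : ℕ, 0 < n → q ^ n ≠ 1) {S : Set B} (hS : Algebra.adjoin 𝕜 S = ⊤)
    (h : ∀ s ∈ S, ∀ t ∈ S, ∃ n, HasWeight q s t n) : NoZeroDivisors B := by
  -- Zero generators are discarded because separating weights requires regular elements.
  let t : {s : S // (s : B) ≠ 0} → B := fun s => s.1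
  have hcomm : ∀ w, ∀ b ∈ weightSpace q t w, ∀ s ∈ S, ∃ n, HasWeight q b s n := by
    intro w b hb s hs
    by_cases h0 : s = 0
    · exact ⟨0, h0 ▸ HasWeight.zero _ _⟩
    · exact ⟨_, (hb ⟨⟨s, hs⟩, h0⟩).symm hq0⟩
  have hmul : ∀ i j, ∀ a ∈ weightSpace q t i, ∀ b ∈ weightSpace q t j,
      a * b ∈ weightSpace q t (i + j) := fun i j a ha b hb k => (ha k).mul hq0 (hb k)
  have htop : ∀ b : B, b ∈ ⨆ w, weightSpace q t w := by
    intro b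
    refine mem_iSup_of_mem_adjoin (weightSpace q t) (fun _ => HasWeight.one _) hmul
      (fun s hs => ?_) (hS ▸ Algebra.mem_top : b ∈ Algebra.adjoin 𝕜 S)
    choose c hc using fun i : {s : S // (s : B) ≠ 0} => h i.1 i.1.2 s hs
    exact ⟨c, hc⟩
  refine ⟨fun {a b} hab => eq_zero_or_eq_zero_of_mem_iSup (weightSpace q t) (weightSpace q t)
    (fun F f hf hsum => eq_zero_of_sum_eq_zero_of_hasWeight hq0 hq t
      (fun s b => (isRegular_of_hasWeight hB hq0 hS s.2 (h s.1 s.1.2) b).2)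
      (fun i j => h _ i.1.2 _ j.1.2) F id f Function.injective_id.injOn hf hsum)
    hmul (fun i j a ha b hb hab => ?_) (htop a) (htop b) hab⟩
  rw [or_iff_not_imp_left]
  intro ha0
  exact (isRegular_of_hasWeight hB hq0 hS ha0 (hcomm i a ha) b).1 hab

end Weights

end QuantumAgeing
namespace QuantumAgeing

/-! ### Homogeneous relations between two commuting elements -/

section Forms

variable {𝕜 B : Type*} [Field 𝕜] [Ring B] [Algebra 𝕜 B] {q : 𝕜}

/-- The value of the form of degree `d` with coefficients `c` at `(x, p)`. -/
def form (x p : B) (d : ℕ) (c : ℕ → 𝕜) : B :=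
  ∑ i ∈ Finset.range (d + 1), c i • (p ^ i * x ^ (d - i))

theorem form_sub (x p : B) (d : ℕ) (a b : ℕ → 𝕜) :
    form x p d (fun i => a i - b i) = form x p d a - form x p d b := by
  simp [form, sub_smul, Finset.sum_sub_distrib]

theorem form_const_mul (x p : B) (d : ℕ) (r : 𝕜) (a : ℕ → 𝕜) :
    form x p d (fun i => r * a i) = r • form x p d a := by
  simp [form, mul_smul, Finset.smul_sum]

theorem form_succ_of_coeff_zero (x p : B) (d : ℕ) (c : ℕ → 𝕜) (h : c 0 = 0) :
    form x p (d + 1) c = p * form x p d (fun i => c (i + 1)) := by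
  rw [form, Finset.sum_range_succ', h, zero_smul, add_zero, form, Finset.mul_sum]
  refine Finset.sum_congr rfl fun i _ => ?_
  rw [mul_smul_comm, pow_succ', mul_assoc]
  simp

theorem form_succ_of_coeff_last (x p : B) (d : ℕ) (c : ℕ → 𝕜) (h : c (d + 1) = 0) :
    form x p (d + 1) c = form x p d c * x := by
  rw [form, Finset.sum_range_succ, h, zero_smul, add_zero, form, Finset.sum_mul]
  refine Finset.sum_congr rfl fun i hi => ?_
  have : d + 1 - i = (d - i) + 1 := by have := Finset.mem_range.1 hi; omega
  rw [smul_mul_assoc, this, pow_succ, mul_assoc]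

theorem mul_form (hq0 : q ≠ 0) {x p v : B} {m n : ℤ} (hx : HasWeight q v x m)
    (hp : HasWeight q v p n) (d : ℕ) (c : ℕ → 𝕜) :
    v * form x p d c = form x p d (fun i => q ^ (i * n + (d - i : ℕ) * m) * c i) * v := by
  rw [form, Finset.mul_sum, form, Finset.sum_mul]
  refine Finset.sum_congr rfl fun i _ => ?_
  rw [mul_smul_comm, (hp.pow hq0 i).mul hq0 (hx.pow hq0 (d - i)), smul_smul, smul_mul_assoc,
    mul_comm]

/-- A relation of minimal degree among commuting regular elements determines the quotient of its
first two coefficients if twisting its coefficients by `m` and multiplying by a linear form gives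
another relation. -/
theorem coeff_eq_of_form_mul_eq_zero {x p : B} (hxp : Commute p x)
    (hx : ∀ b, b * x = 0 → b = 0) (hp : ∀ b, p * b = 0 → b = 0) {d : ℕ}
    (ih : ∀ c : ℕ → 𝕜, form x p d c = 0 → ∀ i ≤ d, c i = 0) {c m : ℕ → 𝕜} {s : 𝕜}
    (hc : form x p (d + 1) c = 0) (hc0 : c 0 ≠ 0)
    (h : form x p (d + 1) (fun i => m i * c i) * (p - s • x) = 0) :
    (m 0 - m (d + 1)) * c 0 = s * (m 1 - m 0) * c 1 := by
  -- Subtracting `m (d + 1)` times the original relation removes the pure power of `p`, so a factor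
  -- `x` splits off and can be cancelled.
  set r : ℕ → 𝕜 := fun i => m i * c i - m (d + 1) * c i with hr
  have hrlast : r (d + 1) = 0 := sub_self _
  have h1 : form x p (d + 1) r * (p - s • x) = 0 := by
    rw [hr, form_sub, form_const_mul x p (d + 1) (m (d + 1)) c, hc, smul_zero, sub_zero, h]
  rw [form_succ_of_coeff_last x p d r hrlast, mul_assoc,
    ((hxp.symm.sub_right ((Commute.refl x).smul_right s))).eq, ← mul_assoc] at h1
  have h2 := hx _ h1
  -- The shift `r1` encodes multiplication by `p`, so `r1 - s * r` is a relation of degree `d + 1`.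
  -- Eliminating its constant coefficient against `c` and cancelling `p` leaves degree `d`, where
  -- `ih` kills all coefficients; the lowest one gives the claim.
  set r1 : ℕ → 𝕜 := fun i => Nat.casesOn i 0 r with hr1
  have h3 : form x p (d + 1) (fun i => r1 i - s * r i) = 0 := by
    rw [form_sub, form_const_mul, form_succ_of_coeff_last x p d r hrlast,
      form_succ_of_coeff_zero x p d r1 rfl]
    have hcomm : p * form x p d r = form x p d r * p := by
      rw [form, Finset.mul_sum, Finset.sum_mul]
      refine Finset.sum_congr rfl fun i _ => ?_
      exact (((Commute.refl p).pow_right i).mul_right (hxp.pow_right _)).smul_right _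
    change p * form x p d r - _ = 0
    rw [hcomm, ← mul_smul_comm, ← mul_sub, h2]
  have h4 : form x p (d + 1) (fun i => (r1 0 - s * r 0) * c i - c 0 * (r1 i - s * r i)) = 0 := by
    rw [form_sub, form_const_mul x p (d + 1) _ c, hc, form_const_mul, h3]
    simp
  rw [form_succ_of_coeff_zero _ _ _ _ (by ring)] at h4
  have h5 := ih _ (hp _ h4) 0 (Nat.zero_le d)
  have e0 : r1 0 = 0 := rfl
  have e1 : r1 1 = r 0 := rfl
  simp only [zero_add, e0, e1] at h5
  simp only [hr] at h5
  apply mul_left_cancel₀ hc0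
  linear_combination -h5

/-- Two commuting regular elements satisfy no nontrivial homogeneous relation if relations
can be twisted in two opposite directions. -/
theorem coeff_eq_zero_of_form_eq_zero [Nontrivial B] (hq0 : q ≠ 0)
    (hq : ∀ n : ℕ, 0 < n → q ^ n ≠ 1) {x p : B} (hxp : Commute p x)
    (hx : ∀ b, b * x = 0 → b = 0) (hp : ∀ b, p * b = 0 → b = 0)
    (hE : ∀ (d : ℕ) (c : ℕ → 𝕜), form x p d c = 0 →
      form x p d (fun i => q ^ (i * (-1) + (d - i : ℕ) * 1 : ℤ) * c i) * (p - q ^ 2 • x) = 0)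
    (hY : ∀ (d : ℕ) (c : ℕ → 𝕜), form x p d c = 0 →
      form x p d (fun i => q ^ (i * 1 + (d - i : ℕ) * (-1) : ℤ) * c i) * (p - (1 : 𝕜) • x) = 0)
    (d : ℕ) : ∀ c : ℕ → 𝕜, form x p d c = 0 → ∀ i ≤ d, c i = 0 := by
  induction d with
  | zero =>
    intro c hc i hi
    obtain rfl : i = 0 := by omega
    simpa [form] using hc
  | succ d ih =>
    intro c hc
    have hc0 : c 0 = 0 := by
      by_contra hc0
      have h1 := coeff_eq_of_form_mul_eq_zero hxp hx hp ih hc hc0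
        (m := fun i => q ^ (i * (-1) + (d + 1 - i : ℕ) * 1 : ℤ)) (hE _ c hc)
      have h2 := coeff_eq_of_form_mul_eq_zero hxp hx hp ih hc hc0
        (m := fun i => q ^ (i * 1 + (d + 1 - i : ℕ) * (-1) : ℤ)) (hY _ c hc)
      set Q : 𝕜 := q ^ (d : ℤ) with hQ
      have hQ0 : Q ≠ 0 := zpow_ne_zero _ hq0
      have e1 : q ^ (((0 : ℕ) : ℤ) * (-1) + ((d + 1 - 0 : ℕ) : ℤ) * 1) = Q * q := by
        rw [hQ, ← zpow_add_one₀ hq0]; congr 1; push_cast; ring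
      have e2 : q ^ (((d + 1 : ℕ) : ℤ) * (-1) + ((d + 1 - (d + 1) : ℕ) : ℤ) * 1) =
          (Q * q)⁻¹ := by
        rw [hQ, ← zpow_add_one₀ hq0, ← zpow_neg]; congr 1; push_cast; simp
      have e3 : q ^ (((1 : ℕ) : ℤ) * (-1) + ((d + 1 - 1 : ℕ) : ℤ) * 1) = Q * q⁻¹ := by
        rw [hQ, ← zpow_sub_one₀ hq0]; congr 1; push_cast; simp; ring
      have e4 : q ^ (((0 : ℕ) : ℤ) * 1 + ((d + 1 - 0 : ℕ) : ℤ) * (-1)) = (Q * q)⁻¹ := by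
        rw [hQ, ← zpow_add_one₀ hq0, ← zpow_neg]; congr 1; push_cast; ring
      have e5 : q ^ (((d + 1 : ℕ) : ℤ) * 1 + ((d + 1 - (d + 1) : ℕ) : ℤ) * (-1)) = Q * q := by
        rw [hQ, ← zpow_add_one₀ hq0]; congr 1; push_cast; simp
      have e6 : q ^ (((1 : ℕ) : ℤ) * 1 + ((d + 1 - 1 : ℕ) : ℤ) * (-1)) = (Q * q⁻¹)⁻¹ := by
        rw [hQ, ← zpow_sub_one₀ hq0, ← zpow_neg]; congr 1; push_cast; simp; ring
      simp only [e1, e2, e3, e4, e5, e6] at h1 h2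
      field_simp at h1 h2
      -- Eliminating `c 1` from the two twists leaves this equation; as `Q * q = q ^ (d + 1)`, it
      -- would make `q` a root of unity.
      have h3 : ((Q * q) ^ 2 - 1) ^ 2 * c 0 = 0 := by
        linear_combination -h1 - (Q * q) ^ 2 * h2
      have h4 : (Q * q) ^ 2 - 1 = 0 := by
        rcases mul_eq_zero.1 h3 with h | h
        · exact pow_eq_zero_iff (two_ne_zero) |>.1 h
        · exact absurd h hc0
      refine hq ((d + 1) * 2) (by omega) ?_
      rw [pow_mul, pow_succ q d, ← zpow_natCast q d]
      exact sub_eq_zero.1 h4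
    rw [form_succ_of_coeff_zero _ _ _ _ hc0] at hc
    rintro (_ | i) hi
    · exact hc0
    · exact ih _ (hp _ hc) i (by omega)

theorem pow_mul_eq_zero {x : B} (hx : ∀ b, x * b = 0 → b = 0) (n : ℕ) (b : B)
    (h : x ^ n * b = 0) : b = 0 := by
  induction n with
  | zero => simpa using h
  | succ n ih => exact ih (hx _ (by rw [← mul_assoc, ← pow_succ', h]))

/-- The subalgebra generated by two elements `x`, `p` without homogeneous relations is a domain. -/
theorem eq_zero_or_eq_zero_of_mem_adjoin_pair (hq0 : q ≠ 0) (hq : ∀ n : ℕ, 0 < n → q ^ n ≠ 1)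
    {x p : B} (hxp : Commute p x) (hx : ∀ b, x * b = 0 → b = 0) (hp : ∀ b, p * b = 0 → b = 0)
    (u : Bˣ) (hux : HasWeight q (u : B) x 1) (hup : HasWeight q (u : B) p 1)
    (hform : ∀ (d : ℕ) (c : ℕ → 𝕜), form x p d c = 0 → ∀ i ≤ d, c i = 0) {a b : B}
    (ha : a ∈ Algebra.adjoin 𝕜 {x, p}) (hb : b ∈ Algebra.adjoin 𝕜 {x, p}) (hab : a * b = 0) :
    a = 0 ∨ b = 0 := by
  classical
  let N : ℕ × ℕ → Submodule 𝕜 B := fun j => Submodule.span 𝕜 {p ^ j.1 * x ^ j.2}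
  have hmul : ∀ i j, ∀ a ∈ N i, ∀ b ∈ N j, a * b ∈ N (i + j) := by
    intro i j a ha b hb
    obtain ⟨r, rfl⟩ := Submodule.mem_span_singleton.1 ha
    obtain ⟨s, rfl⟩ := Submodule.mem_span_singleton.1 hb
    refine Submodule.mem_span_singleton.2 ⟨r * s, ?_⟩
    rw [smul_mul_smul_comm, Prod.fst_add, Prod.snd_add, pow_add, pow_add, mul_assoc, mul_assoc,
      ← mul_assoc (x ^ i.2), ← (hxp.pow_pow j.1 i.2).eq, mul_assoc]
  have hsup : ∀ b ∈ Algebra.adjoin 𝕜 {x, p}, b ∈ ⨆ j, N j := by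
    intro b hb
    refine mem_iSup_of_mem_adjoin N (Submodule.mem_span_singleton.2 ⟨1, by simp⟩) hmul ?_ hb
    rintro s (rfl | rfl)
    · exact ⟨(0, 1), Submodule.mem_span_singleton.2 ⟨1, by simp⟩⟩
    · exact ⟨(1, 0), Submodule.mem_span_singleton.2 ⟨1, by simp⟩⟩
  refine eq_zero_or_eq_zero_of_mem_iSup N N ?_ hmul ?_ (hsup a ha) (hsup b hb) hab
  · intro S f hf hsum
    choose! c hc using fun j hj => Submodule.mem_span_singleton.1 (hf j hj)
    rw [← Finset.sum_fiberwise_of_maps_to (g := fun j : ℕ × ℕ => j.1 + j.2)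
        (t := S.image fun j => j.1 + j.2) (fun j hj => Finset.mem_image_of_mem _ hj)] at hsum
    -- The weight of a monomial with respect to `u` is its total degree, so each homogeneous
    -- component vanishes separately.
    have h0 := eq_zero_of_sum_eq_zero_of_hasWeight hq0 hq (fun _ : Unit => (u : B))
      (fun _ b h => by simpa using h) (fun _ _ => ⟨0, by simp [HasWeight]⟩) _
      (fun (d : ℕ) _ => (d : ℤ)) _ (fun a _ b _ h => by simpa using congrFun h ())
      (fun d _ _ => by
        refine Finset.sum_induction _ (fun b => HasWeight q (u : B) b d)
          (fun _ _ ha hb => ha.add hb) (HasWeight.zero _ _) fun j hj => ?_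
        obtain ⟨hjS, rfl⟩ := Finset.mem_filter.1 hj
        rw [← hc j hjS]
        have := ((hup.pow hq0 j.1).mul hq0 (hux.pow hq0 j.2)).smul (c j)
        simpa using this) hsum
    intro j hj
    have h1 := h0 _ (Finset.mem_image_of_mem _ hj)
    set d := j.1 + j.2 with hd
    have h2 : form x p d (fun i => if (i, d - i) ∈ S then c (i, d - i) else 0) = 0 := by
      rw [← h1, form, ← Finset.Nat.sum_antidiagonal_eq_sum_range_succ_mk
        (fun ij => (if ij ∈ S then c ij else 0) • (p ^ ij.1 * x ^ ij.2))]
      have : S.filter (fun i => i.1 + i.2 = d) =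
          (Finset.HasAntidiagonal.antidiagonal d).filter (fun i => i ∈ S) := by
        ext i
        simp [and_comm]
      rw [this, Finset.sum_filter]
      refine Finset.sum_congr rfl fun i _ => ?_
      split_ifs with hi
      · exact hc i hi
      · exact zero_smul _ _
    have h3 := hform d _ h2 j.1 (by omega)
    have h4 : (j.1, d - j.1) = j := by
      ext <;> simp [hd]
    rw [h4, if_pos hj] at h3
    rw [← hc j hj, h3, zero_smul]
  · intro i j a ha b _ hab
    obtain ⟨r, rfl⟩ := Submodule.mem_span_singleton.1 ha
    rw [smul_mul_assoc, smul_eq_zero] at hab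
    rcases hab with rfl | hab
    · exact Or.inl (zero_smul _ _)
    · rw [mul_assoc] at hab
      exact Or.inr (pow_mul_eq_zero hx _ _ (pow_mul_eq_zero hp _ _ hab))

end Forms

end QuantumAgeing
namespace QuantumAgeing

/-! ### The defining relations and the second normal element -/

section Ageing

variable {𝕜 B : Type*} [Field 𝕜] [Ring B] [Algebra 𝕜 B] {q : 𝕜}

/-- The defining relations of the quantum spatial ageing algebra, for elements of an algebra. -/
structure AgeingRelations (q : 𝕜) (E : B) (K : Bˣ) (X Y : B) : Prop where
  E_K : HasWeight q E (K : B) (-2)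
  X_K : HasWeight q X (K : B) (-1)
  Y_K : HasWeight q Y (K : B) 1
  E_X : HasWeight q E X 1
  E_Y : E * Y = X + q⁻¹ • (Y * E)
  X_Y : HasWeight q X Y 1

/-- The second normal element `φ = X + (q⁻¹ - q) Y E`. -/
def normalElt (q : 𝕜) (E X Y : B) : B := X + (q⁻¹ - q) • (Y * E)

namespace AgeingRelations

variable {E X Y : B} {K : Bˣ}

theorem normalElt_K (hq0 : q ≠ 0) (h : AgeingRelations q E K X Y) :
    HasWeight q (normalElt q E X Y) (K : B) (-1) := by
  rw [← neg_neg (1 : ℤ)]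
  refine ((h.X_K.symm hq0).add (HasWeight.smul _ ?_)).symm hq0
  exact (h.Y_K.symm hq0).mul hq0 (h.E_K.symm hq0)

theorem X_normalElt (hq0 : q ≠ 0) (h : AgeingRelations q E K X Y) :
    HasWeight q X (normalElt q E X Y) 0 :=
  HasWeight.add (by simp [HasWeight])
    (HasWeight.smul _ (h.X_Y.mul hq0 (h.E_X.symm hq0)))

/-- The coefficient `q⁻¹ - q` is chosen for this: `E * X` contributes `q` and the extra term of `E *
Y` contributes `q⁻¹ - q`, which add up to `q⁻¹`. The same cancellation serves `Y`. -/
theorem E_normalElt (hq0 : q ≠ 0) (h : AgeingRelations q E K X Y) :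
    HasWeight q E (normalElt q E X Y) (-1) := by
  have hEX : E * X = q • (X * E) := by simpa [HasWeight] using h.E_X
  unfold HasWeight normalElt
  rw [mul_add, mul_smul_comm, ← mul_assoc, h.E_Y, hEX]
  simp only [add_mul, smul_mul_assoc, mul_assoc, smul_add, smul_smul, zpow_neg, zpow_one]
  match_scalars <;> field_simp
  ring

theorem Y_normalElt (hq0 : q ≠ 0) (h : AgeingRelations q E K X Y) :
    HasWeight q Y (normalElt q E X Y) 1 := by
  have hYX : X * Y = q • (Y * X) := by simpa [HasWeight] using h.X_Y
  unfold HasWeight normalElt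
  rw [add_mul, smul_mul_assoc, mul_assoc, h.E_Y, hYX]
  simp only [mul_add, mul_smul_comm, smul_add, smul_smul, zpow_one]
  match_scalars <;> field_simp
  ring

/-- This and `smul_E_mul_Y` supply the linear factors `p - s • x`, with `s = 1` and `s = q ^ 2`, by
which twisted relations are multiplied. -/
theorem smul_Y_mul_E : (q⁻¹ - q) • (Y * E) = normalElt q E X Y - (1 : 𝕜) • X := by
  simp [normalElt]

theorem smul_E_mul_Y (hq0 : q ≠ 0) (h : AgeingRelations q E K X Y) :
    (q⁻¹ - q) • (E * Y) = q⁻¹ • (normalElt q E X Y - q ^ 2 • X) := by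
  rw [h.E_Y]
  unfold normalElt
  match_scalars <;> field_simp

end AgeingRelations

end Ageing

end QuantumAgeing
namespace QuantumAgeing

/-! ### Absence of zero divisors in prime quotients -/

section Domain

variable {𝕜 B : Type*} [Field 𝕜] [Ring B] [Algebra 𝕜 B] {q : 𝕜}

/-- Products of powers of opposite ladder elements are nonzero elements of a subalgebra `D`
without zero divisors, as soon as this holds for the first powers. -/
theorem pow_mul_pow_mem_and_ne_zero [Nontrivial B] (hq0 : q ≠ 0) {S : Set B} {u v : B}
    (hv : ∀ s ∈ S, ∃ n, HasWeight q v s n)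
    (hD : ∀ a ∈ Algebra.adjoin 𝕜 S, ∀ b ∈ Algebra.adjoin 𝕜 S, a * b = 0 → a = 0 ∨ b = 0)
    (huv : u * v ∈ Algebra.adjoin 𝕜 S) (hvu : v * u ∈ Algebra.adjoin 𝕜 S)
    (huv0 : u * v ≠ 0) (hvu0 : v * u ≠ 0) (n : ℕ) :
    u ^ n * v ^ n ∈ Algebra.adjoin 𝕜 S ∧ u ^ n * v ^ n ≠ 0 := by
  induction n with
  | zero => simp
  | succ n ih =>
    -- Carrying the inner product `u ^ n * v ^ n` past the last `v` brings `u` and `v` together.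
    obtain ⟨d, hd, e⟩ := exists_mul_eq_mul_right hq0 hv ih.1
    have key : u ^ (n + 1) * v ^ (n + 1) = u * v * d := by
      rw [pow_succ' u, pow_succ v, mul_assoc u v d, ← e]
      simp only [mul_assoc]
    rw [key]
    refine ⟨mul_mem huv hd, fun h0 => ?_⟩
    have hd0 : d = 0 := (hD _ huv _ hd h0).resolve_left huv0
    rw [hd0, mul_zero] at e
    have : u ^ n * v ^ n * (v * u) = 0 := by rw [← mul_assoc, e, zero_mul]
    rcases hD _ ih.1 _ hvu this with h | h
    · exact ih.2 h
    · exact hvu0 h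

/-- The element `E ^ n` for `n ≥ 0`, and `Y ^ (-n)` for `n ≤ 0`. -/
def ladder (E Y : B) (n : ℤ) : B := E ^ n.toNat * Y ^ (-n).toNat

theorem ladder_natCast (E Y : B) (n : ℕ) : ladder E Y n = E ^ n := by simp [ladder]

theorem ladder_neg_natCast (E Y : B) (n : ℕ) : ladder E Y (-n) = Y ^ n := by simp [ladder]

theorem HasWeight.ladder (hq0 : q ≠ 0) {t E Y : B} {m : ℤ} (hE : HasWeight q t E m)
    (hY : HasWeight q t Y (-m)) (n : ℤ) : HasWeight q t (ladder E Y n) (n * m) := by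
  have e : n * m = n.toNat * m + (-n).toNat * -m := by
    conv_lhs => rw [← Int.toNat_sub_toNat_neg n]
    ring
  rw [e]
  exact (hE.pow hq0 n.toNat).mul hq0 (hY.pow hq0 (-n).toNat)

/-- If both products of `E` and `Y` lie in `D`, then `E` maps the piece `Z_n D` to `Z_(n+1) D`. -/
theorem mul_ladder_left (hq0 : q ≠ 0) {S : Set B} {E Y : B}
    (hY : ∀ s ∈ S, ∃ n, HasWeight q Y s n) (hEY : E * Y ∈ Algebra.adjoin 𝕜 S) (n : ℤ) :
    ∃ d ∈ Algebra.adjoin 𝕜 S, E * ladder E Y n = ladder E Y (n + 1) * d := by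
  by_cases hn : 0 ≤ n
  · obtain ⟨m, rfl⟩ := Int.eq_ofNat_of_zero_le hn
    refine ⟨1, one_mem _, ?_⟩
    have := ladder_natCast E Y (m + 1)
    rw [Nat.cast_succ] at this
    rw [this, ladder_natCast, mul_one, pow_succ']
  · obtain ⟨m, hm⟩ := Int.eq_ofNat_of_zero_le (a := -n - 1) (by omega)
    obtain rfl : n = -((m + 1 : ℕ) : ℤ) := by push_cast; omega
    have e : -((m + 1 : ℕ) : ℤ) + 1 = -(m : ℤ) := by push_cast; ring
    -- For negative index, `E` meets one `Y`; the resulting `E * Y` lies in the subalgebra and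
    -- passes through the remaining powers of `Y`.
    rw [e, ladder_neg_natCast, ladder_neg_natCast, pow_succ', ← mul_assoc]
    refine exists_mul_eq_mul_right hq0 (fun s hs => ?_) hEY
    obtain ⟨k, hk⟩ := hY s hs
    exact ⟨_, ((hk.symm hq0).pow hq0 m).symm hq0⟩

theorem mul_ladder_right (hq0 : q ≠ 0) {S : Set B} {E Y : B}
    (hE : ∀ s ∈ S, ∃ n, HasWeight q E s n) (hYE : Y * E ∈ Algebra.adjoin 𝕜 S) (n : ℤ) :
    ∃ d ∈ Algebra.adjoin 𝕜 S, Y * ladder E Y n = ladder E Y (n - 1) * d := by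
  have swap (n : ℤ) : ladder Y E (-n) = ladder E Y n := by
    obtain ⟨m, rfl | rfl⟩ := n.eq_nat_or_neg
    · rw [ladder_neg_natCast, ladder_natCast]
    · rw [neg_neg, ladder_neg_natCast, ladder_natCast]
  obtain ⟨d, hd, e⟩ := mul_ladder_left hq0 hE hYE (-n)
  refine ⟨d, hd, ?_⟩
  rw [swap, show -n + 1 = -(n - 1) by ring, swap] at e
  exact e

/-- The generic case: both normal elements are regular, and everything reduces to the commutative
domain `D` they generate. -/
theorem AgeingRelations.noZeroDivisors_of_ne_zero [Nontrivial B] (hB : IsPrimeRing B)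
    (hq0 : q ≠ 0) (hq : ∀ n : ℕ, 0 < n → q ^ n ≠ 1) {E X Y : B} {K : Bˣ}
    (h : AgeingRelations q E K X Y)
    (hS : Algebra.adjoin 𝕜 {E, (K : B), ((K⁻¹ : Bˣ) : B), X, Y} = ⊤) (hX0 : X ≠ 0)
    (hp0 : normalElt q E X Y ≠ 0) : NoZeroDivisors B := by
  set p := normalElt q E X Y with hp
  have hEp : HasWeight q E p (-1) := h.E_normalElt hq0
  have hYp : HasWeight q Y p 1 := h.Y_normalElt hq0
  have hXp : HasWeight q X p 0 := h.X_normalElt hq0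
  have hpK : HasWeight q p (K : B) (-1) := h.normalElt_K hq0
  have hYX : HasWeight q Y X (-1) := h.X_Y.symm hq0
  have hKX : HasWeight q (K : B) X 1 := by simpa using h.X_K.symm hq0
  have hKp : HasWeight q (K : B) p 1 := by simpa using hpK.symm hq0
  have hcomm : Commute p X := by
    have : X * p = p * X := by simpa [HasWeight] using hXp
    exact this.symm
  -- regularity of `X` and `p`
  have hXreg := isRegular_of_hasWeight hB hq0 hS hX0 (by
    rintro s (rfl | rfl | rfl | rfl | rfl)
    exacts [⟨_, h.E_X.symm hq0⟩, ⟨_, h.X_K⟩, ⟨_, h.X_K.inv hq0⟩, ⟨0, by simp [HasWeight]⟩,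
      ⟨_, h.X_Y⟩])
  have hpreg := isRegular_of_hasWeight hB hq0 hS hp0 (by
    rintro s (rfl | rfl | rfl | rfl | rfl)
    exacts [⟨_, hEp.symm hq0⟩, ⟨_, hpK⟩, ⟨_, hpK.inv hq0⟩, ⟨_, hXp.symm hq0⟩,
      ⟨_, hYp.symm hq0⟩])
  have hlam : q⁻¹ - q ≠ 0 := by
    intro h0
    apply hq 2 two_pos
    field_simp at h0
    linear_combination -h0
  -- the subalgebra generated by `X` and `p`
  set D := Algebra.adjoin 𝕜 {X, p} with hDdef
  have hXD : X ∈ D := Algebra.subset_adjoin (by simp)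
  have hpD : p ∈ D := Algebra.subset_adjoin (by simp)
  have hED : ∀ s ∈ ({X, p} : Set B), ∃ n, HasWeight q E s n := by
    rintro s (rfl | rfl)
    exacts [⟨_, h.E_X⟩, ⟨_, hEp⟩]
  have hYD : ∀ s ∈ ({X, p} : Set B), ∃ n, HasWeight q Y s n := by
    rintro s (rfl | rfl)
    exacts [⟨_, hYX⟩, ⟨_, hYp⟩]
  have hYE : Y * E = (q⁻¹ - q)⁻¹ • (p - (1 : 𝕜) • X) := by
    rw [hp, ← smul_Y_mul_E, inv_smul_smul₀ hlam]
  have hEY : E * Y = (q⁻¹ - q)⁻¹ • (q⁻¹ • (p - q ^ 2 • X)) := by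
    rw [hp, ← h.smul_E_mul_Y hq0, inv_smul_smul₀ hlam]
  have hform := coeff_eq_zero_of_form_eq_zero (𝕜 := 𝕜) hq0 hq hcomm (fun b => (hXreg b).2)
    (fun b => (hpreg b).1)
    -- Moving `E` through the relation twists its coefficients and leaves a factor `E` on the right;
    -- multiplying by `Y` turns that into the linear form `E * Y`.
    (fun d c hc => by
      have h1 := mul_form hq0 h.E_X hEp d c
      rw [hc, mul_zero] at h1
      have h2 := congrArg (fun b => b * Y) h1.symm
      simp only [zero_mul, mul_assoc] at h2
      rw [hEY, mul_smul_comm, mul_smul_comm, smul_eq_zero_iff_right (inv_ne_zero hlam),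
        smul_eq_zero_iff_right (inv_ne_zero hq0)] at h2
      exact h2)
    (fun d c hc => by
      have h1 := mul_form hq0 hYX hYp d c
      rw [hc, mul_zero] at h1
      have h2 := congrArg (fun b => b * E) h1.symm
      simp only [zero_mul, mul_assoc] at h2
      rw [hYE, mul_smul_comm, smul_eq_zero_iff_right (inv_ne_zero hlam)] at h2
      exact h2)
  have hD : ∀ a ∈ D, ∀ b ∈ D, a * b = 0 → a = 0 ∨ b = 0 := fun a ha b hb =>
    eq_zero_or_eq_zero_of_mem_adjoin_pair hq0 hq hcomm (fun b => (hXreg b).1)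
      (fun b => (hpreg b).1) K hKX hKp hform ha hb
  -- `E Y` and `Y E` are nonzero elements of `D`
  have hlin (r : 𝕜) : p - r • X ≠ 0 := by
    intro h0
    have := hform 1 (fun i => if i = 0 then -r else 1)
      (by simp [form, Finset.sum_range_succ, ← h0]; abel) 1 le_rfl
    simp at this
  have hlinD (r : 𝕜) : p - r • X ∈ D := sub_mem hpD (Subalgebra.smul_mem _ hXD r)
  have hYEmem : Y * E ∈ D := hYE ▸ Subalgebra.smul_mem _ (hlinD _) _
  have hEYmem : E * Y ∈ D := hEY ▸ Subalgebra.smul_mem _ (Subalgebra.smul_mem _ (hlinD _) _) _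
  have hYE0 : Y * E ≠ 0 := hYE ▸ smul_ne_zero (inv_ne_zero hlam) (hlin _)
  have hEY0 : E * Y ≠ 0 :=
    hEY ▸ smul_ne_zero (inv_ne_zero hlam) (smul_ne_zero (inv_ne_zero hq0) (hlin _))
  have hladder (n : ℤ) : ladder E Y (-n) * ladder E Y n ∈ D ∧
      ladder E Y (-n) * ladder E Y n ≠ 0 := by
    obtain ⟨m, rfl | rfl⟩ := n.eq_nat_or_neg
    · rw [ladder_neg_natCast, ladder_natCast]
      exact pow_mul_pow_mem_and_ne_zero hq0 hED hD hYEmem hEYmem hYE0 hEY0 m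
    · rw [neg_neg, ladder_neg_natCast, ladder_natCast]
      exact pow_mul_pow_mem_and_ne_zero hq0 hYD hD hEYmem hYEmem hEY0 hYE0 m
  -- the graded pieces
  let g : ℤ × ℤ → B := fun j => ((K ^ j.1 : Bˣ) : B) * ladder E Y j.2
  let N : ℤ × ℤ → Submodule 𝕜 B := fun j =>
    (Subalgebra.toSubmodule D).map (LinearMap.mulLeft 𝕜 (g j))
  have memN {j : ℤ × ℤ} {b : B} : b ∈ N j ↔ ∃ d ∈ D, g j * d = b := Iff.rfl
  let t : Bool → B := fun i => bif i then X else p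
  -- These are the weights of `g j` for `X` and `p`. Their sum and difference recover `j`, so
  -- distinct pieces have distinct weights.
  let w : ℤ × ℤ → Bool → ℤ := fun j i => bif i then -j.1 - j.2 else -j.1 + j.2
  have hg (j : ℤ × ℤ) (i : Bool) : HasWeight q (t i) (g j) (w j i) := by
    cases i
    · have e : w j false = j.1 * (-1) + j.2 * 1 := by simp only [w, cond_false]; ring
      rw [e]
      exact (hpK.zpow hq0 j.1).mul hq0
        (HasWeight.ladder hq0 (by simpa using hEp.symm hq0) (hYp.symm hq0) j.2)
    · have e : w j true = j.1 * (-1) + j.2 * (-1) := by simp only [w, cond_true]; ring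
      rw [e]
      exact (h.X_K.zpow hq0 j.1).mul hq0
        (HasWeight.ladder hq0 (h.E_X.symm hq0) (by simpa using h.X_Y) j.2)
  have hDt {d : B} (hd : d ∈ D) (i : Bool) : HasWeight q (t i) d 0 := by
    have h1 : D ≤ Subalgebra.centralizer 𝕜 {t i} := by
      refine Algebra.adjoin_le ?_
      rintro s (rfl | rfl) <;> rw [SetLike.mem_coe, Subalgebra.mem_centralizer_iff] <;>
        rintro _ rfl <;> cases i
      exacts [hcomm.eq, rfl, rfl, hcomm.symm.eq]
    have h2 := (Subalgebra.mem_centralizer_iff 𝕜).1 (h1 hd) _ rfl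
    simpa [HasWeight] using h2
  have hgD (j : ℤ × ℤ) : ∀ s ∈ ({X, p} : Set B), ∃ n, HasWeight q (g j) s n := by
    rintro s (rfl | rfl)
    exacts [⟨_, (hg j true).symm hq0⟩, ⟨_, (hg j false).symm hq0⟩]
  have hNw {j : ℤ × ℤ} {b : B} (hb : b ∈ N j) (i : Bool) : HasWeight q (t i) b (w j i) := by
    obtain ⟨d, hd, rfl⟩ := memN.1 hb
    simpa using (hg j i).mul hq0 (hDt hd i)
  have hw : Function.Injective w := by
    intro a b hab
    have h1 := congrFun hab true
    have h2 := congrFun hab false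
    simp only [w, cond_true, cond_false] at h1 h2
    ext <;> omega
  have hwadd (i j : ℤ × ℤ) (k : Bool) : w (i + j) k = w i k + w j k := by
    cases k <;> simp [w] <;> ring
  -- the pieces span
  have hcross {v : B} {n : ℤ} (hv : HasWeight q v (K : B) n) {e : ℤ}
      (hvl : ∀ n, ∃ d ∈ D, v * ladder E Y n = ladder E Y (n + e) * d) (j : ℤ × ℤ) :
      ∀ b ∈ N j, v * b ∈ ⨆ j, N j := by
    intro b hb
    obtain ⟨d, hd, rfl⟩ := memN.1 hb
    obtain ⟨d', hd', e'⟩ := hvl j.2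
    refine Submodule.mem_iSup_of_mem (j.1, j.2 + e)
      (memN.2 ⟨q ^ (j.1 * n) • (d' * d), Subalgebra.smul_mem _ (mul_mem hd' hd) _, ?_⟩)
    have h1 := hv.zpow hq0 j.1
    unfold HasWeight at h1
    simp only [g]
    rw [← mul_assoc v, ← mul_assoc v, h1, smul_mul_assoc, smul_mul_assoc, mul_assoc _ v, e',
      mul_smul_comm]
    simp only [mul_assoc]
  have hKK (k : ℤ) (j : ℤ × ℤ) : ∀ b ∈ N j, ((K ^ k : Bˣ) : B) * b ∈ ⨆ j, N j := by
    intro b hb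
    obtain ⟨d, hd, rfl⟩ := memN.1 hb
    refine Submodule.mem_iSup_of_mem (k + j.1, j.2) (memN.2 ⟨d, hd, ?_⟩)
    simp only [g, zpow_add, Units.val_mul, mul_assoc]
  have hleft (s : B) (hs : s ∈ ({E, (K : B), ((K⁻¹ : Bˣ) : B), X, Y} : Set B)) (j : ℤ × ℤ) :
      ∀ b ∈ N j, s * b ∈ ⨆ j, N j := by
    rcases hs with rfl | rfl | rfl | rfl | rfl
    · exact hcross h.E_K (mul_ladder_left hq0 hYD hEYmem) j
    · simpa using hKK 1 j
    · simpa using hKK (-1) j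
    · refine hcross h.X_K (e := 0) (fun n => ?_) j
      rw [add_zero]
      refine exists_mul_eq_mul_right hq0 (fun s hs => ?_) hXD
      rcases hs with rfl | rfl
      · exact ⟨_, (HasWeight.ladder hq0 (h.E_X.symm hq0) (by simpa using h.X_Y) n).symm hq0⟩
      · exact ⟨_, (HasWeight.ladder hq0 (m := 1) (by simpa using hEp.symm hq0)
          (hYp.symm hq0) n).symm hq0⟩
    · exact hcross h.Y_K (mul_ladder_right hq0 hED hYEmem) j
  have htop (b : B) : b ∈ ⨆ j, N j := by
    have hb : b ∈ Algebra.adjoin 𝕜 {E, (K : B), ((K⁻¹ : Bˣ) : B), X, Y} := hS ▸ Algebra.mem_top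
    have key : ∀ u ∈ ⨆ j, N j, b * u ∈ ⨆ j, N j := by
      induction hb using Algebra.adjoin_induction with
      | mem s hs =>
        intro u hu
        have : (⨆ j, N j) ≤ (⨆ j, N j).comap (LinearMap.mulLeft 𝕜 s) :=
          iSup_le fun j u hu => hleft s hs j u hu
        exact this hu
      | algebraMap r =>
        intro u hu
        rw [← Algebra.smul_def]
        exact Submodule.smul_mem _ r hu
      | add x y _ _ hx hy =>
        intro u hu
        rw [add_mul]
        exact add_mem (hx u hu) (hy u hu)
      | mul x y _ _ hx hy =>
        intro u hu
        rw [mul_assoc]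
        exact hx _ (hy u hu)
    have h1 : (1 : B) ∈ ⨆ j, N j :=
      Submodule.mem_iSup_of_mem (0, 0) (memN.2 ⟨1, one_mem _, by simp [g, ladder]⟩)
    simpa using key 1 h1
  -- Products are only tracked in the weight spaces, which contain the pieces `N j`; independence
  -- already holds there.
  refine ⟨fun {a b} hab => eq_zero_or_eq_zero_of_mem_iSup N (fun j => weightSpace q t (w j))
    (fun F f hf hsum => eq_zero_of_sum_eq_zero_of_hasWeight hq0 hq t ?_ ?_ F w f hw.injOn hf hsum)
    (fun i j a ha b hb k => ?_) (fun i j a ha b hb hab => ?_) (htop a) (htop b) hab⟩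
  · intro i b
    cases i
    exacts [(hpreg b).2, (hXreg b).2]
  · intro i j
    refine ⟨0, hDt ?_ i⟩
    cases j
    exacts [hpD, hXD]
  · rw [hwadd]
    exact (hNw ha k).mul hq0 (hNw hb k)
  · obtain ⟨d, hd, rfl⟩ := memN.1 ha
    obtain ⟨d₀, hd₀, rfl⟩ := memN.1 hb
    obtain ⟨d₁, hd₁, e₁⟩ := exists_mul_eq_mul_left (hgD j) hd₀
    rw [e₁] at hab ⊢
    obtain ⟨hz, hz0⟩ := hladder i.2
    obtain ⟨hy, hy0⟩ := hladder (-j.2)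
    rw [neg_neg] at hy hy0
    obtain ⟨d₂, hd₂, e₂⟩ := exists_mul_eq_mul_left (v := ((K ^ j.1 : Bˣ) : B)) (S := {X, p})
      (q := q) (by
        rintro s (rfl | rfl)
        exacts [⟨_, (h.X_K.zpow hq0 j.1).symm hq0⟩, ⟨_, (hpK.zpow hq0 j.1).symm hq0⟩]) hy
    have hd₂0 : d₂ ≠ 0 := by
      rintro rfl
      rw [zero_mul, Units.mul_right_eq_zero] at e₂
      exact hy0 e₂
    -- After cancelling the unit `K ^ i.1`, opposite ladder elements are multiplied on both sides,
    -- so that up to the unit `K ^ j.1` every factor lies in `D`.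
    have h1 : ladder E Y i.2 * (d * (d₁ * g j)) = 0 := by
      simp only [g, mul_assoc] at hab ⊢
      exact (Units.mul_right_eq_zero _).1 hab
    have h2 : ladder E Y (-i.2) * ladder E Y i.2 * (d * (d₁ * d₂)) * ((K ^ j.1 : Bˣ) : B) = 0 := by
      have := congrArg (fun b => ladder E Y (-i.2) * b * ladder E Y (-j.2)) h1
      simp only [mul_zero, zero_mul, g, mul_assoc] at this
      simp only [mul_assoc]
      rwa [← e₂]
    rw [Units.mul_left_eq_zero] at h2
    have h3 := (hD _ hz _ (mul_mem hd (mul_mem hd₁ hd₂)) h2).resolve_left hz0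
    rcases hD _ hd _ (mul_mem hd₁ hd₂) h3 with h4 | h4
    · exact Or.inl (by rw [h4, mul_zero])
    · have h5 := (hD _ hd₁ _ hd₂ h4).resolve_right hd₂0
      exact Or.inr (by rw [h5, zero_mul])

/-- In the degenerate cases the relation for `E * Y` loses its extra term: `X = 0` gives `E * Y =
q⁻¹ • (Y * E)`, and a vanishing normal element gives `E * Y = q • (Y * E)`. -/
theorem AgeingRelations.noZeroDivisors [Nontrivial B] (hB : IsPrimeRing B)
    (hq0 : q ≠ 0) (hq : ∀ n : ℕ, 0 < n → q ^ n ≠ 1) {E X Y : B} {K : Bˣ}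
    (h : AgeingRelations q E K X Y)
    (hS : Algebra.adjoin 𝕜 {E, (K : B), ((K⁻¹ : Bˣ) : B), X, Y} = ⊤) : NoZeroDivisors B := by
  by_cases hcase : X ≠ 0 ∧ normalElt q E X Y ≠ 0
  · exact h.noZeroDivisors_of_ne_zero hB hq0 hq hS hcase.1 hcase.2
  have hEY : ∃ n, HasWeight q E Y n := by
    have e := h.E_Y
    by_cases hX : X = 0
    · refine ⟨-1, ?_⟩
      rw [hX, zero_add] at e
      simpa [HasWeight] using e
    · have hp : normalElt q E X Y = 0 := by
        by_contra hp
        exact hcase ⟨hX, hp⟩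
      refine ⟨1, ?_⟩
      have hX' : X = -((q⁻¹ - q) • (Y * E)) := eq_neg_of_add_eq_zero_left hp
      rw [hX'] at e
      unfold HasWeight
      rw [e, zpow_one]
      module
  obtain ⟨n, hn⟩ := hEY
  have hsymm {a b : B} (hab : ∃ n, HasWeight q a b n) : ∃ n, HasWeight q b a n :=
    hab.imp' _ fun _ h => h.symm hq0
  have self (a : B) : ∃ n, HasWeight q a a n := ⟨0, by simp [HasWeight]⟩
  have inv {a : B} {n : ℤ} (ha : HasWeight q a (K : B) n) :
      ∃ n, HasWeight q a ((K⁻¹ : Bˣ) : B) n := ⟨_, ha.inv hq0⟩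
  have hK : ∃ n, HasWeight q (K : B) ((K⁻¹ : Bˣ) : B) n := ⟨0, by simp [HasWeight]⟩
  refine noZeroDivisors_of_hasWeight hB hq0 hq hS ?_
  rintro s (rfl | rfl | rfl | rfl | rfl) t (rfl | rfl | rfl | rfl | rfl)
  exacts [self _, ⟨_, h.E_K⟩, inv h.E_K, ⟨_, h.E_X⟩, ⟨_, hn⟩,
    hsymm ⟨_, h.E_K⟩, self _, hK, hsymm ⟨_, h.X_K⟩, hsymm ⟨_, h.Y_K⟩,
    hsymm (inv h.E_K), hsymm hK, self _, hsymm (inv h.X_K), hsymm (inv h.Y_K),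
    hsymm ⟨_, h.E_X⟩, ⟨_, h.X_K⟩, inv h.X_K, self _, ⟨_, h.X_Y⟩,
    hsymm ⟨_, hn⟩, ⟨_, h.Y_K⟩, inv h.Y_K, hsymm ⟨_, h.X_Y⟩, self _]

end Domain

/-! ### From prime ideals to prime quotient rings -/

section Quotient

variable {A : Type*} [Ring A]

theorem mk_eq_zero_iff (P : TwoSidedIdeal A) (a : A) : P.ringCon.mk' a = 0 ↔ a ∈ P := by
  rw [TwoSidedIdeal.mem_iff, ← map_zero P.ringCon.mk']
  exact RingCon.eq _

theorem IsPrimeIdeal.mem_or_mem {P : TwoSidedIdeal A} (hP : IsPrimeIdeal P) {a b : A}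
    (hab : ∀ r, a * r * b ∈ P) : a ∈ P ∨ b ∈ P := by
  -- Taking `I` and `J` as successive annihilators modulo `P` makes them two-sided ideals with `I J
  -- ⊆ P`, `a ∈ I` and `b ∈ J`, without describing generated ideals.
  let I : TwoSidedIdeal A := TwoSidedIdeal.mk' {x | ∀ r, x * r * b ∈ P}
    (fun r => by simp)
    (fun hx hy r => by rw [add_mul, add_mul]; exact P.add_mem (hx r) (hy r))
    (fun hx r => by rw [neg_mul, neg_mul]; exact P.neg_mem (hx r))
    (fun {x y} hy r => by rw [mul_assoc x y, mul_assoc x]; exact P.mul_mem_left _ _ (hy r))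
    (fun {x y} hx r => by rw [mul_assoc x y]; exact hx _)
  let J : TwoSidedIdeal A := TwoSidedIdeal.mk' {y | ∀ x ∈ I, ∀ r, x * r * y ∈ P}
    (fun x _ r => by simp)
    (fun hy hz x hx r => by rw [mul_add]; exact P.add_mem (hy x hx r) (hz x hx r))
    (fun hy x hx r => by rw [mul_neg]; exact P.neg_mem (hy x hx r))
    (fun {z y} hy x hx r => by rw [← mul_assoc, mul_assoc x r]; exact hy x hx _)
    (fun {y z} hy x hx r => by rw [← mul_assoc]; exact P.mul_mem_right _ _ (hy x hx r))
  have memI {x : A} : x ∈ I ↔ ∀ r, x * r * b ∈ P := TwoSidedIdeal.mem_mk' ..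
  have memJ {y : A} : y ∈ J ↔ ∀ x ∈ I, ∀ r, x * r * y ∈ P := TwoSidedIdeal.mem_mk' ..
  rcases hP.2 I J (fun x hx y hy => by simpa using memJ.1 hy x hx 1) with h | h
  · exact Or.inl (h (memI.2 hab))
  · exact Or.inr (h (memJ.2 fun x hx r => memI.1 hx r))

theorem IsPrimeIdeal.isPrimeRing {P : TwoSidedIdeal A} (hP : IsPrimeIdeal P) :
    IsPrimeRing P.ringCon.Quotient := by
  intro a b hab
  obtain ⟨a, rfl⟩ := P.ringCon.mk'_surjective a
  obtain ⟨b, rfl⟩ := P.ringCon.mk'_surjective b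
  rw [mk_eq_zero_iff, mk_eq_zero_iff]
  refine hP.mem_or_mem fun r => ?_
  rw [← mk_eq_zero_iff, map_mul, map_mul]
  exact hab _

theorem IsPrimeIdeal.nontrivial {P : TwoSidedIdeal A} (hP : IsPrimeIdeal P) :
    Nontrivial P.ringCon.Quotient := by
  refine ⟨P.ringCon.mk' 1, 0, fun h => hP.1 ?_⟩
  rw [mk_eq_zero_iff] at h
  exact P.one_mem_iff.1 h

open AgeingGen in
theorem IsPrimeIdeal.isCompletelyPrimeIdeal {𝕜 : Type*} [Field 𝕜] {q : 𝕜} (hq0 : q ≠ 0)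
    (hq : ∀ n : ℕ, 0 < n → q ^ n ≠ 1) {P : TwoSidedIdeal (QuantumAgeingAlgebra q)}
    (hP : IsPrimeIdeal P) : IsCompletelyPrimeIdeal P := by
  have := hP.nontrivial
  let π : FreeAlgebra 𝕜 AgeingGen →ₐ[𝕜] P.ringCon.Quotient :=
    (P.ringCon.mkₐ 𝕜).comp (RingQuot.mkAlgHom 𝕜 (Rel q))
  have hrel {a b : FreeAlgebra 𝕜 AgeingGen} (hab : Rel q a b) : π a = π b :=
    congrArg (P.ringCon.mkₐ 𝕜) (RingQuot.mkAlgHom_rel 𝕜 hab)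
  let K' : P.ringCon.Quotientˣ := ⟨π (gen 𝕜 K), π (gen 𝕜 Kinv),
    by simpa using hrel Rel.K_Kinv, by simpa using hrel Rel.Kinv_K⟩
  have h : AgeingRelations q (π (gen 𝕜 E)) K' (π (gen 𝕜 X)) (π (gen 𝕜 Y)) :=
    { E_K := by simpa [HasWeight, zpow_neg] using hrel Rel.E_K
      X_K := by simpa [HasWeight] using hrel Rel.X_K
      Y_K := by simpa [HasWeight] using hrel Rel.Y_K
      E_X := by simpa [HasWeight] using hrel Rel.E_X
      E_Y := by simpa using hrel Rel.E_Y
      X_Y := by simpa [HasWeight] using (hrel Rel.Y_X).symm }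
  have hS : Algebra.adjoin 𝕜 {π (gen 𝕜 E), (K' : P.ringCon.Quotient),
      ((K'⁻¹ : P.ringCon.Quotientˣ) : P.ringCon.Quotient), π (gen 𝕜 X), π (gen 𝕜 Y)} = ⊤ := by
    have h1 : (⊤ : Subalgebra 𝕜 P.ringCon.Quotient) =
        Algebra.adjoin 𝕜 (Set.range fun g => π (gen 𝕜 g)) := by
      have h2 : Function.Surjective π :=
        (RingCon.mkₐ_surjective (α := 𝕜) P.ringCon).comp (RingQuot.mkAlgHom_surjective 𝕜 (Rel q))
      rw [Set.range_comp' π (gen 𝕜), Algebra.adjoin_image, FreeAlgebra.adjoin_range_ι,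
        Algebra.map_top, (AlgHom.range_eq_top π).2 h2]
    refine top_le_iff.1 (h1.le.trans (Algebra.adjoin_mono ?_))
    rintro _ ⟨g, rfl⟩
    cases g
    exacts [Or.inl rfl, Or.inr (Or.inl rfl), Or.inr (Or.inr (Or.inl rfl)),
      Or.inr (Or.inr (Or.inr (Or.inl rfl))), Or.inr (Or.inr (Or.inr (Or.inr rfl)))]
  have := h.noZeroDivisors hP.isPrimeRing hq0 hq hS
  exact ⟨hP, NoZeroDivisors.to_isDomain _⟩

end Quotient

end QuantumAgeing

theorem corollary2 {𝕜 : Type*} [Field 𝕜] (q : 𝕜) (hq0 : q ≠ 0)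
    (hq : ∀ n : ℕ, 0 < n → q ^ n ≠ 1) :
    (∀ P : TwoSidedIdeal (QuantumAgeingAlgebra q),
      QuantumAgeing.IsPrimeIdeal P → QuantumAgeing.IsCompletelyPrimeIdeal P) ∧
    QuantumAgeing.SpecC (QuantumAgeingAlgebra q) =
      QuantumAgeing.Spec (QuantumAgeingAlgebra q) := by
  have key := fun P hP =>
    QuantumAgeing.IsPrimeIdeal.isCompletelyPrimeIdeal (P := P) hq0 hq hP
  exact ⟨key, Set.ext fun P => ⟨fun h => h.1, key P⟩⟩
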